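/- Let $p$ be a prime, $F$ a field of characteristic $p$, $G$ a finite group and $N\unlhd G$ a normal subgroup. Write $J(R)$ for the Jacobson radical of a ring $R$, put $A=F[G]$, regard $F[N]$ as a subalgebra of $A$, and let $$I=\{\alpha\in A \mid x\alpha=0 \text{ for all } x\in J(F[N])\}$$ be the right annihilator of $J(F[N])$ in $A$. A principal indecomposable $A$-module is a nonzero indecomposable left ideal of $A$ that is a direct summand of the left regular module. A $p$-block of $G$ is $B=Ae_B$, where the block idempotent $e_B$ is a primitive idempotent of the center of $A$. A left ideal $P$ belongs to $B$ if $e_Bx=x$ for all $x\in P$. (a) If $P_i,P_j$ are principal indecomposable $A$-modules belonging to the same $p$-block, then $P_i\subseteq I$ if and only if $P_j\subseteq I$. (b) For every $p$-block $B=Ae_B$, either $B\subseteq I$ or $B\cap I\subseteq J(B)$. Moreover $B\cap I=Ie_B$ and $J(B)=B\,J(A)=J(A)\,e_B$, where $J(B)$ is the Jacobson radical of the algebra $B$ with identity $e_B$. -/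

import Mathlib

section Blocks

variable {A : Type*} [Ring A]

/-- A principal indecomposable (left) `A`-module: a nonzero left ideal of `A` that is a direct
summand of the left regular module and is not a direct sum of two nonzero submodules. -/
structure IsPrincipalIndecomposable (P : Ideal A) : Prop where
  ne_bot : P ≠ ⊥
  summand : ∃ Q : Ideal A, IsCompl P Q
  indecomposable : ∀ U V : Ideal A, Disjoint U V → U ⊔ V = P → U = ⊥ ∨ V = ⊥

/-- A block idempotent of `A`: a primitive idempotent of the center of `A`. -/
structure IsBlockIdempotent (e : A) : Prop where
  central : e ∈ Set.center A
  idem : IsIdempotentElem e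
  ne_zero : e ≠ 0
  primitive : ∀ f g : A, f ∈ Set.center A → g ∈ Set.center A →
    IsIdempotentElem f → IsIdempotentElem g → f * g = 0 → f + g = e → f = 0 ∨ g = 0

/-- The left ideal `P` (as a module) belongs to the block with block idempotent `e`:
`e` acts as the identity on `P`. -/
def BelongsToBlock (e : A) (P : Ideal A) : Prop :=
  ∀ x ∈ P, e * x = x

/-- The block (algebra) `A e` attached to a block idempotent `e`. -/
def blockIdeal (e : A) : Ideal A := Ideal.span {e}

/-- The Jacobson radical of the block algebra `e A e` (equal to `A e` when `e` is central),
formed in this algebra, whose identity is `e`, and then regarded as a subset of `A`. -/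
def blockRadical {e : A} (he : IsIdempotentElem e) : Set A :=
  (fun x : he.Corner => (x.1 : A)) '' (Ring.jacobson he.Corner : Set he.Corner)

end Blocks

/-- The right annihilator `{α ∈ F[G] | J(F[N]) α = 0}` in `F[G]` of the Jacobson radical of `F[N]`,
where `F[N]` is regarded as a subalgebra of `F[G]` through the inclusion of `N` in `G`. -/
def radicalRightAnnihilator (F : Type*) [Field F] {G : Type*} [Group G] (N : Subgroup G) :
    Submodule F (MonoidAlgebra F G) where
  carrier := {α | ∀ x ∈ Ring.jacobson (MonoidAlgebra F N),
    MonoidAlgebra.mapDomainRingHom F N.subtype x * α = 0}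
  add_mem' := by
    intro a b ha hb x hx
    rw [mul_add, ha x hx, hb x hx, add_zero]
  zero_mem' := by
    intro x _
    rw [mul_zero]
  smul_mem' := by
    intro c a ha x hx
    rw [mul_smul_comm, ha x hx, smul_zero]

/-! ### Radicals, annihilators and idempotents in rings. -/

section RingTheory

variable {R : Type*} [Ring R]

/-! Everything follows from a central idempotent `f` of `F[G]` lying in `I` with `x f - x ∈ J(F[G])`
for all `x ∈ I`. For a block idempotent `e`, primitivity gives `e f = e`, so that `e ∈ I`, or `e f =
0`, so that `I e ⊆ J(F[G])`.

To find `f`, let `r` be the right annihilator of `J = J(F[N])` in `F[N]`. Its image in the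
semisimple ring `F[N]/J` is generated by an idempotent. Group algebras are symmetric, so also `r J =
0`, which makes the idempotent lift into `r` and the lift unique. Uniqueness makes it invariant
under conjugation by `G`, hence central in `F[G]`. The congruence passes from `F[N]` to `F[G]` by
coset decomposition, because `J ⊆ J(F[G])`. -/

theorem Ring.mem_jacobson_of_forall_isNilpotent_mul {x : R} (h : ∀ y, IsNilpotent (y * x)) :
    x ∈ Ring.jacobson R := by
  rw [← Ideal.jacobson_bot, Ideal.mem_jacobson_iff]
  intro y
  obtain ⟨u, hu⟩ := (h y).isUnit_add_one
  refine ⟨↑u⁻¹, ?_⟩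
  have h1 : (↑u⁻¹ : R) * (y * x + 1) = 1 := by rw [← hu, Units.inv_mul]
  rw [Ideal.mem_bot, mul_assoc, ← h1]
  noncomm_ring

theorem Ring.mem_jacobson_iff_exists_mul_add_one {x : R} :
    x ∈ Ring.jacobson R ↔ ∀ y, ∃ z, z * (y * x + 1) = 1 := by
  rw [← Ideal.jacobson_bot, Ideal.mem_jacobson_iff]
  simp only [Ideal.mem_bot, sub_eq_zero, mul_add, mul_one, mul_assoc]

/-- If the right annihilator of the Jacobson radical of a semiprimary ring also annihilates it
from the other side, then modulo the radical it is generated by an idempotent which is a two-sided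
identity for products of two of its elements. -/
theorem exists_idempotent_of_jacobson_annihilator [IsSemiprimaryRing R]
    (hsym : ∀ x : R, (∀ j ∈ Ring.jacobson R, j * x = 0) → ∀ j ∈ Ring.jacobson R, x * j = 0) :
    ∃ f : R, IsIdempotentElem f ∧ (∀ j ∈ Ring.jacobson R, j * f = 0) ∧
      (∀ x y : R, (∀ j ∈ Ring.jacobson R, j * x = 0) → (∀ j ∈ Ring.jacobson R, j * y = 0) →
        x * y * f = x * y ∧ f * (x * y) = x * y) ∧
      ∀ x : R, (∀ j ∈ Ring.jacobson R, j * x = 0) → x * f - x ∈ Ring.jacobson R := by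
  set J := Ring.jacobson R with hJ
  let r : Ideal R :=
    { carrier := {x | ∀ j ∈ J, j * x = 0}
      add_mem' := fun ha hb j hj ↦ by rw [mul_add, ha j hj, hb j hj, add_zero]
      zero_mem' := fun j _ ↦ mul_zero j
      smul_mem' := fun c x hx j hj ↦ by
        rw [smul_eq_mul, ← mul_assoc, hx _ (J.mul_mem_right c hj)] }
  obtain ⟨ε, hε, hspan⟩ :=
    IsSemisimpleRing.ideal_eq_span_idempotent (r.map (Ideal.Quotient.mk J))
  obtain ⟨a, ha, rfl⟩ : ∃ a ∈ r, Ideal.Quotient.mk J a = ε :=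
    (Ideal.mem_map_iff_of_surjective _ Ideal.Quotient.mk_surjective).1
      (hspan ▸ Ideal.mem_span_singleton_self ε)
  have hxa : ∀ x ∈ r, x * a - x ∈ J := by
    intro x hx
    have h1 : Ideal.Quotient.mk J x ∈ Ideal.span {Ideal.Quotient.mk J a} :=
      hspan ▸ Ideal.mem_map_of_mem _ hx
    obtain ⟨c, hc⟩ := Ideal.mem_span_singleton'.1 h1
    rw [← Ideal.Quotient.eq, map_mul, ← hc, mul_assoc, hε.eq]
  -- `a` is idempotent only modulo `J`, but `a J = 0` forces `a³ = a²`, so `a²` is idempotent.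
  have haa : a * (a * a) = a * a := by
    rw [← sub_eq_zero, ← mul_sub, hsym a ha _ (hxa a ha)]
  have hf : a * a ∈ r := r.mul_mem_left a ha
  have hxf : ∀ x ∈ r, x * (a * a) - x ∈ J := by
    intro x hx
    have : x * (a * a) - x = (x * a - x) * a + (x * a - x) := by noncomm_ring
    rw [this, ha _ (hxa x hx), zero_add]
    exact hxa x hx
  refine ⟨a * a, ?_, hf, ?_, hxf⟩
  · rw [IsIdempotentElem, mul_assoc, haa, haa]
  · intro x y hx hy
    constructor
    · rw [← sub_eq_zero, mul_assoc x y, ← mul_sub, hsym x hx _ (hxf y hy)]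
    -- The generator acts from the right; for the left side, `d = a²x - x` satisfies `r d = 0` and
    -- `d z ∈ r`, so `(z d)² = z (d z) d = 0`.
    · have hd : a * a * x - x ∈ J := by
        refine Ring.mem_jacobson_of_forall_isNilpotent_mul fun z ↦ ⟨2, ?_⟩
        have hdr : a * a * x - x ∈ r := r.sub_mem (r.mul_mem_left _ hx) hx
        have key : ∀ w ∈ r, w * (a * a * x - x) = 0 := by
          intro w hw
          have : w * (a * a * x - x) = (w * (a * a) - w) * x := by noncomm_ring
          rw [this, hx _ (hxf w hw)]
        rw [sq, mul_assoc, ← mul_assoc (a * a * x - x) z]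
        have hdz : (a * a * x - x) * z ∈ r := fun j hj ↦ by
          rw [← mul_assoc, hdr j hj, zero_mul]
        rw [key _ hdz, mul_zero]
      rw [← sub_eq_zero, ← mul_assoc, ← sub_mul, hy _ hd]

theorem RingEquiv.map_mem_jacobson {S : Type*} [Ring S] (σ : R ≃+* S) {x : R}
    (hx : x ∈ Ring.jacobson R) : σ x ∈ Ring.jacobson S := by
  have : RingHomSurjective (σ : R →+* S) := ⟨σ.surjective⟩
  exact Ring.le_comap_jacobson (σ : R →+* S) hx

/-- The Jacobson radical of the block algebra `A e` is `J(A) e`. -/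
theorem blockRadical_eq {e : R} (hc : e ∈ Set.center R) (he : IsIdempotentElem e) :
    blockRadical he = (fun a => a * e) '' (Ring.jacobson R : Set R) := by
  have hcomm : ∀ x, x * e = e * x := Semigroup.mem_center_iff.1 hc
  have hcorner : ∀ x : he.Corner, e * x.1 = x.1 ∧ x.1 * e = x.1 := fun x ↦
    (Subsemigroup.mem_corner_iff he).1 x.2
  let m : R → he.Corner := fun x ↦ ⟨e * x * e, x, rfl⟩
  have hm : ∀ x, (m x).1 = e * x := fun x ↦ by
    change e * x * e = _
    rw [mul_assoc, hcomm, ← mul_assoc, he.eq]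
  have hmul : ∀ x y : he.Corner, (x * y).1 = x.1 * y.1 := fun _ _ ↦ rfl
  have hadd : ∀ x y : he.Corner, (x + y).1 = x.1 + y.1 := fun _ _ ↦ rfl
  have hone : (1 : he.Corner).1 = e := rfl
  ext x
  constructor
  · rintro ⟨x, hx, rfl⟩
    refine ⟨x.1, ?_, (hcorner x).2⟩
    rw [SetLike.mem_coe, Ring.mem_jacobson_iff_exists_mul_add_one] at hx ⊢
    intro y
    obtain ⟨z, hz⟩ := hx (m y)
    have hz' : z.1 * (e * y * x.1 + e) = e := by
      have := congrArg Subtype.val hz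
      rwa [hmul, hadd, hmul, hm, hone] at this
    have hyx : e * y * x.1 = y * x.1 := by rw [← hcomm, mul_assoc, (hcorner x).1]
    have hyx' : e * (y * x.1) = y * x.1 := by rw [← mul_assoc, hyx]
    -- A left inverse in the corner extends to `R` by the identity on the complementary factor.
    refine ⟨z.1 + (1 - e), ?_⟩
    rw [hyx] at hz'
    have h1 : (z.1 + (1 - e)) * (y * x.1 + 1) =
        z.1 * (y * x.1 + e) + (z.1 - z.1 * e) + (y * x.1 - e * (y * x.1)) + (1 - e) := by
      noncomm_ring
    rw [h1, hz', (hcorner z).2, hyx']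
    noncomm_ring
  · rintro ⟨a, ha, rfl⟩
    refine ⟨m a, ?_, by simp only [hm, hcomm]⟩
    rw [SetLike.mem_coe, Ring.mem_jacobson_iff_exists_mul_add_one] at ha ⊢
    intro y
    obtain ⟨z, hz⟩ := ha y.1
    refine ⟨m z, Subtype.ext ?_⟩
    rw [hmul, hadd, hmul, hm, hm, hone, ← mul_assoc, (hcorner y).2, ← hcomm, mul_assoc]
    have : e * (y.1 * a + e) = e * (y.1 * a + 1) := by rw [mul_add, mul_add, he.eq, mul_one]
    rw [this, ← hcomm, ← mul_assoc, hz, one_mul]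

theorem mul_eq_self_of_mem_blockIdeal {e : R} (he : IsIdempotentElem e) {x : R}
    (hx : x ∈ blockIdeal e) : x * e = x := by
  obtain ⟨a, rfl⟩ := Ideal.mem_span_singleton'.1 hx
  rw [mul_assoc, he.eq]

theorem coe_blockIdeal_mul {e : R} (hc : e ∈ Set.center R) (he : IsIdempotentElem e)
    (K : Ideal R) : ((blockIdeal e * K : Ideal R) : Set R) = (fun a => a * e) '' (K : Set R) := by
  have hec := Semigroup.mem_center_iff.1 hc
  have hle : blockIdeal e * K ≤ blockIdeal e :=
    Ideal.mul_le.2 fun m hm n _ ↦ Ideal.mem_span_singleton'.2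
      ⟨m * n, by rw [mul_assoc, hec, ← mul_assoc, mul_eq_self_of_mem_blockIdeal he hm]⟩
  ext x
  constructor
  · intro hx
    exact ⟨x, Ideal.mul_le_right hx, mul_eq_self_of_mem_blockIdeal he (hle hx)⟩
  · rintro ⟨a, ha, rfl⟩
    have : e * a ∈ blockIdeal e * K := Ideal.mul_mem_mul (Ideal.mem_span_singleton_self e) ha
    rwa [← hec] at this

end RingTheory

/-! ### Group algebras and normal subgroups. -/

namespace MonoidAlgebra

variable {F G : Type*} [Field F] [Group G]

/-- This is the symmetrizing trace form of the group algebra. -/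
theorem coeff_mul_one_comm (a b : MonoidAlgebra F G) : (a * b).coeff 1 = (b * a).coeff 1 := by
  induction a using MonoidAlgebra.induction_linear with
  | zero => simp
  | add x y hx hy => simp [add_mul, mul_add, hx, hy]
  | single g r => simp [mul_comm]

/-- Left and right annihilators of a two-sided ideal in a group algebra coincide. -/
theorem mul_eq_zero_of_forall_mem_mul_eq_zero (K : Ideal (MonoidAlgebra F G)) [K.IsTwoSided]
    {x : MonoidAlgebra F G} (hx : ∀ j ∈ K, j * x = 0) {j : MonoidAlgebra F G} (hj : j ∈ K) :
    x * j = 0 := by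
  refine MonoidAlgebra.ext (Finsupp.ext fun g ↦ ?_)
  -- Each coefficient of `x j` is a trace of `x (j g⁻¹)`, hence of `(j g⁻¹) x`, and `j g⁻¹ ∈ K`.
  have h1 : (x * j * single g⁻¹ 1).coeff 1 = (x * j).coeff g := by
    rw [coeff_mul_single_apply, inv_inv, one_mul, mul_one]
  rw [← h1, mul_assoc, coeff_mul_one_comm, hx _ (K.mul_mem_right _ hj)]
  rfl

variable (N : Subgroup G)

local notation "ι" => mapDomainRingHom F N.subtype

/-- Restriction of the support to a subgroup. -/
noncomputable def restrict (x : MonoidAlgebra F G) : MonoidAlgebra F N :=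
  comapDomain N.subtype N.subtype_injective x

@[simp]
theorem coeff_restrict (x : MonoidAlgebra F G) (n : N) : (restrict N x).coeff n = x.coeff n := by
  simp [restrict]

theorem restrict_mapDomainRingHom_mul (x : MonoidAlgebra F N) (y : MonoidAlgebra F G) :
    restrict N (ι x * y) = x * restrict N y := by
  induction x using MonoidAlgebra.induction_linear with
  | zero => ext; simp
  | add a b ha hb =>
    rw [map_add, add_mul, add_mul, ← ha, ← hb]
    ext; simp
  | single g r => ext; simp

variable [N.Normal]

/-- Conjugation by a group element on the group algebra of a normal subgroup. -/
noncomputable def conjNormal (g : G) : MonoidAlgebra F N ≃+* MonoidAlgebra F N :=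
  mapDomainRingEquiv F (MulAut.conjNormal g)

theorem single_mul_mapDomainRingHom (g : G) (c : F) (x : MonoidAlgebra F N) :
    single g c * ι x = ι (conjNormal N g x) * single g c := by
  induction x using MonoidAlgebra.induction_linear with
  | zero => simp
  | add a b ha hb => rw [map_add, map_add, map_add, mul_add, add_mul, ha, hb]
  | single n r => simp [conjNormal, mul_comm]

theorem mapDomainRingHom_mul_single (g : G) (c : F) (x : MonoidAlgebra F N) :
    ι x * single g c = single g c * ι (conjNormal N g⁻¹ x) := by
  induction x using MonoidAlgebra.induction_linear with
  | zero => simp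
  | add a b ha hb => rw [map_add, map_add, map_add, mul_add, add_mul, ha, hb]
  | single n r => simp [conjNormal, mul_comm, mul_assoc]

/-- Elements of the radical move past group elements at the cost of a conjugation, which preserves
the radical. This bounds powers of the left ideal of `F[G]` generated by `J(F[N])`. -/
theorem mul_mem_span_image_mul (K : Ideal (MonoidAlgebra F N)) {x y : MonoidAlgebra F G}
    (hx : x ∈ Ideal.span (ι '' Ring.jacobson (MonoidAlgebra F N)))
    (hy : y ∈ Ideal.span (ι '' K)) :
    x * y ∈ Ideal.span (ι '' (Ring.jacobson (MonoidAlgebra F N) * K : Ideal _)) := by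
  have key : ∀ j ∈ Ring.jacobson (MonoidAlgebra F N), ι j * y ∈
      Ideal.span (ι '' (Ring.jacobson (MonoidAlgebra F N) * K : Ideal _)) := by
    induction hy using Submodule.span_induction with
    | mem y hy =>
      obtain ⟨k, hk, rfl⟩ := hy
      intro j hj
      rw [← map_mul]
      exact Ideal.subset_span ⟨_, Ideal.mul_mem_mul hj hk, rfl⟩
    | zero => intro j _; rw [mul_zero]; exact zero_mem _
    | add a b _ _ ha hb => intro j hj; rw [mul_add]; exact add_mem (ha j hj) (hb j hj)
    | smul a b _ hb =>
      intro j hj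
      rw [smul_eq_mul, ← mul_assoc]
      induction a using MonoidAlgebra.induction_linear with
      | zero => simp
      | add c d hc hd => rw [mul_add, add_mul]; exact add_mem hc hd
      | single g c =>
        rw [mapDomainRingHom_mul_single, mul_assoc]
        exact Ideal.mul_mem_left _ _ (hb _ ((conjNormal N g⁻¹).map_mem_jacobson hj))
  induction hx using Submodule.span_induction with
  | mem x hx =>
    obtain ⟨j, hj, rfl⟩ := hx
    exact key j hj
  | zero => rw [zero_mul]; exact zero_mem _
  | add a b _ _ ha hb => rw [add_mul]; exact add_mem ha hb
  | smul a b _ hb => rw [smul_eq_mul, mul_assoc]; exact Ideal.mul_mem_left _ _ hb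

/-- The nilpotent ideal `J(F[N])` generates a nilpotent left ideal of `F[G]`. -/
theorem mapDomainRingHom_mem_jacobson [Finite G] {j : MonoidAlgebra F N}
    (hj : j ∈ Ring.jacobson (MonoidAlgebra F N)) : ι j ∈ Ring.jacobson (MonoidAlgebra F G) := by
  have : IsArtinianRing (MonoidAlgebra F N) := IsArtinianRing.of_finite F _
  obtain ⟨n, hn⟩ := IsSemiprimaryRing.isNilpotent (R := MonoidAlgebra F N)
  -- The induction starts at exponent 1, since `Submodule.pow_succ'` needs a nonzero exponent.
  refine Ring.mem_jacobson_of_forall_isNilpotent_mul fun y ↦ ⟨n + 1, ?_⟩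
  have hmem : y * ι j ∈ Ideal.span (ι '' Ring.jacobson (MonoidAlgebra F N)) :=
    Ideal.mul_mem_left _ _ (Ideal.subset_span ⟨j, hj, rfl⟩)
  have hpow : ∀ k, (y * ι j) ^ (k + 1) ∈
      Ideal.span (ι '' (Ring.jacobson (MonoidAlgebra F N) ^ (k + 1) : Ideal _)) := by
    intro k
    induction k with
    | zero => rwa [zero_add, pow_one, Submodule.pow_one]
    | succ k ih =>
      rw [pow_succ', Submodule.pow_succ' _ k.succ_ne_zero]
      exact mul_mem_span_image_mul N _ hmem ih
  have hzero : Ring.jacobson (MonoidAlgebra F N) ^ (n + 1) = ⊥ := by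
    rw [Submodule.pow_succ, hn]
    exact Submodule.bot_mul _
  simpa [hzero] using hpow n

/-- The term at `q` is the part of `x` supported on the coset `N q.out`; normality identifies left
and right cosets. -/
theorem eq_sum_mapDomainRingHom_mul_single [Finite G] [Fintype (G ⧸ N)]
    (x : MonoidAlgebra F G) :
    x = ∑ q : G ⧸ N, ι (restrict N (x * single q.out⁻¹ 1)) * single q.out 1 := by
  have hcoeff : ∀ (y : MonoidAlgebra F G) (g : G), g ∈ N → (ι (restrict N y)).coeff g = y.coeff g := by
    intro y g hg
    exact (Finsupp.mapDomain_apply N.subtype_injective (restrict N y).coeff ⟨g, hg⟩).trans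
      (coeff_restrict N y ⟨g, hg⟩)
  have hcoeff' : ∀ (y : MonoidAlgebra F G) (g : G), g ∉ N → (ι (restrict N y)).coeff g = 0 := by
    intro y g hg
    exact Finsupp.mapDomain_of_notMem_range (f := N.subtype) (restrict N y).coeff g (by simpa using hg)
  refine MonoidAlgebra.ext (Finsupp.ext fun g ↦ ?_)
  rw [coeff_sum, Finset.sum_apply', Finset.sum_eq_single (g : G ⧸ N)]
  · have hg : g * (g : G ⧸ N).out⁻¹ ∈ N := by
      rw [Subgroup.Normal.mem_comm_iff ‹_›, ← QuotientGroup.eq, QuotientGroup.out_eq']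
    rw [coeff_mul_single_apply, hcoeff _ _ hg, coeff_mul_single_apply]
    simp
  · intro q _ hq
    have hg : g * q.out⁻¹ ∉ N := by
      rw [Subgroup.Normal.mem_comm_iff ‹_›, ← QuotientGroup.eq, QuotientGroup.out_eq']
      exact hq
    rw [coeff_mul_single_apply, hcoeff' _ _ hg, zero_mul]
  · simp

end MonoidAlgebra

/-! ### The annihilator `I` and its central idempotent. -/

section RadicalRightAnnihilator

open MonoidAlgebra

variable {F G : Type*} [Field F] [Group G] (N : Subgroup G)

theorem mul_mem_radicalRightAnnihilator {x : MonoidAlgebra F G}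
    (hx : x ∈ radicalRightAnnihilator F N) (y : MonoidAlgebra F G) :
    x * y ∈ radicalRightAnnihilator F N := fun j hj ↦ by
  rw [← mul_assoc, hx j hj, zero_mul]

theorem mul_mem_radicalRightAnnihilator_left [N.Normal] (x : MonoidAlgebra F G)
    {y : MonoidAlgebra F G} (hy : y ∈ radicalRightAnnihilator F N) :
    x * y ∈ radicalRightAnnihilator F N := fun j hj ↦ by
  rw [← mul_assoc]
  induction x using MonoidAlgebra.induction_linear with
  | zero => simp
  | add a b ha hb => rw [mul_add, add_mul, ha, hb, add_zero]
  | single g c =>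
    rw [mapDomainRingHom_mul_single, mul_assoc, hy _ ((conjNormal N g⁻¹).map_mem_jacobson hj),
      mul_zero]

theorem jacobson_mul_restrict {x : MonoidAlgebra F G} (hx : x ∈ radicalRightAnnihilator F N)
    {j : MonoidAlgebra F N} (hj : j ∈ Ring.jacobson (MonoidAlgebra F N)) :
    j * restrict N x = 0 := by
  rw [← restrict_mapDomainRingHom_mul, hx j hj]
  ext; simp

/-- The annihilator of the radical of `F[N]` contains a central idempotent of `F[G]` which
generates it modulo the radical of `F[G]`. -/
theorem exists_central_idempotent_radicalRightAnnihilator [Finite G] [N.Normal] :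
    ∃ f ∈ radicalRightAnnihilator F N, f ∈ Set.center (MonoidAlgebra F G) ∧
      IsIdempotentElem f ∧
      ∀ x ∈ radicalRightAnnihilator F N, x * f - x ∈ Ring.jacobson (MonoidAlgebra F G) := by
  have : IsArtinianRing (MonoidAlgebra F N) := IsArtinianRing.of_finite F _
  obtain ⟨f, hf, hJ, hid, hmod⟩ := exists_idempotent_of_jacobson_annihilator
    (R := MonoidAlgebra F N) fun x hx j hj ↦ mul_eq_zero_of_forall_mem_mul_eq_zero _ hx hj
  have hconj : ∀ g : G, conjNormal N g f = f := by
    intro g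
    set σ : MonoidAlgebra F N ≃+* MonoidAlgebra F N := conjNormal N g
    have hσJ : ∀ j ∈ Ring.jacobson (MonoidAlgebra F N), j * σ f = 0 := fun j hj ↦ by
      rw [← σ.apply_symm_apply j, ← map_mul, hJ _ (σ.symm.map_mem_jacobson hj), map_zero]
    have hσJ' : ∀ j ∈ Ring.jacobson (MonoidAlgebra F N), j * σ.symm f = 0 := fun j hj ↦ by
      rw [← σ.symm_apply_apply j, ← map_mul, hJ _ (σ.map_mem_jacobson hj), map_zero]
    -- Both `f` and `σ f` are identities for the annihilator's idempotents, so `f = f σ(f) = σ f`.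
    have h1 : f * σ f = σ f := by
      have := (hid _ _ hσJ hσJ).2
      rwa [← map_mul, hf.eq] at this
    have h2 : f * σ f = f := by
      have := (hid _ _ hσJ' hσJ').1
      rw [← map_mul, hf.eq] at this
      simpa using congrArg σ this
    exact h1.symm.trans h2
  have hcomm : ∀ x : MonoidAlgebra F N, x * f = f * x := by
    intro x
    have hxf : ∀ j ∈ Ring.jacobson (MonoidAlgebra F N), j * (x * f) = 0 := fun j hj ↦ by
      rw [← mul_assoc, hJ _ (Ideal.mul_mem_right _ _ hj)]
    have hfx : ∀ j ∈ Ring.jacobson (MonoidAlgebra F N), j * (f * x) = 0 := fun j hj ↦ by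
      rw [← mul_assoc, hJ _ hj, zero_mul]
    -- Both `x f` and `f x` equal `f x f`.
    have h1 := (hid _ _ hxf hJ).2
    have h2 := (hid _ _ hJ hfx).1
    rw [mul_assoc x, hf.eq] at h1
    rw [← mul_assoc f, hf.eq] at h2
    rw [← h1, ← h2, mul_assoc]
  have hcentral : ∀ x : MonoidAlgebra F G,
      x * mapDomainRingHom F N.subtype f = mapDomainRingHom F N.subtype f * x := by
    intro x
    induction x using MonoidAlgebra.induction_linear with
    | zero => simp
    | add a b ha hb => rw [add_mul, mul_add, ha, hb]
    | single g c => rw [single_mul_mapDomainRingHom, hconj]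
  refine ⟨mapDomainRingHom F N.subtype f, fun j hj ↦ ?_, Semigroup.mem_center_iff.2 hcentral,
    hf.map _, fun x hx ↦ ?_⟩
  · rw [← map_mul, hJ j hj, map_zero]
  · have := Fintype.ofFinite (G ⧸ N)
    -- The coset components of `x` annihilate the radical inside `F[N]`, where `hmod` applies.
    rw [eq_sum_mapDomainRingHom_mul_single N x, Finset.sum_mul, ← Finset.sum_sub_distrib]
    refine sum_mem fun q _ ↦ ?_
    rw [mul_assoc, hcentral, ← mul_assoc, ← map_mul, ← sub_mul, ← map_sub]
    refine Ideal.mul_mem_right _ _ (mapDomainRingHom_mem_jacobson N (hmod _ fun j hj ↦ ?_))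
    exact jacobson_mul_restrict N (mul_mem_radicalRightAnnihilator N hx _) hj

/-- A block idempotent either lies in the annihilator of the radical of `F[N]`, or the part of
this annihilator in the block lies in the radical. -/
theorem IsBlockIdempotent.mem_radicalRightAnnihilator_or [Finite G] [N.Normal]
    {e : MonoidAlgebra F G} (he : IsBlockIdempotent e) :
    e ∈ radicalRightAnnihilator F N ∨
      ∀ x ∈ radicalRightAnnihilator F N, x * e ∈ Ring.jacobson (MonoidAlgebra F G) := by
  obtain ⟨f, hfI, hfc, hf, hmod⟩ := exists_central_idempotent_radicalRightAnnihilator (F := F) N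
  have hec := Semigroup.mem_center_iff.1 he.central
  have hef : e * f * (e * f) = e * f := by
    rw [mul_assoc, ← mul_assoc f, hec, mul_assoc e f f, hf.eq, ← mul_assoc, he.idem.eq]
  have hcef : e * f ∈ Set.center (MonoidAlgebra F G) := Set.mul_mem_center he.central hfc
  have hefe : e * (e * f) = e * f := by rw [← mul_assoc, he.idem.eq]
  have hefe' : e * f * e = e * f := by rw [hec, hefe]
  have hcent : e - e * f ∈ Set.center (MonoidAlgebra F G) :=
    (Subring.center (MonoidAlgebra F G)).sub_mem he.central hcef
  -- The orthogonal central decomposition `e = e f + (e - e f)` must be trivial.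
  rcases he.primitive (e * f) (e - e * f) hcef hcent hef
      (by rw [IsIdempotentElem, sub_mul, mul_sub, mul_sub, he.idem.eq, hefe, hefe', hef]; simp)
      (by rw [mul_sub, hefe', hef, sub_self]) (by simp) with h | h
  · right
    intro x hx
    have : x * e = -((x * f - x) * e) := by
      rw [sub_mul, mul_assoc x f e, hec f, h, mul_zero, zero_sub, neg_neg]
    rw [this]
    exact neg_mem (Ideal.mul_mem_right _ _ (hmod x hx))
  · left
    rw [sub_eq_zero.1 h]
    exact mul_mem_radicalRightAnnihilator_left N _ hfI

end RadicalRightAnnihilator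

/-! ### Principal indecomposable modules and the main theorem. -/

/-- The component of `1` in `P` along a complement is a right identity on `P`. -/
theorem IsPrincipalIndecomposable.exists_idempotent {A : Type*} [Ring A] {P : Ideal A}
    (hP : IsPrincipalIndecomposable P) : ∃ ε ∈ P, IsIdempotentElem ε ∧ ε ≠ 0 := by
  obtain ⟨Q, hQ⟩ := hP.summand
  obtain ⟨a, ha, b, hb, hab⟩ := Submodule.mem_sup.1
    (hQ.sup_eq_top ▸ Submodule.mem_top : (1 : A) ∈ P ⊔ Q)
  have hx : ∀ x ∈ P, x * a = x := by
    intro x hx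
    have h1 : x * b = x - x * a := by rw [eq_sub_iff_add_eq', ← mul_add, hab, mul_one]
    have h2 : x * b ∈ P := h1 ▸ P.sub_mem hx (P.mul_mem_left _ ha)
    have h3 := (Submodule.disjoint_def.1 hQ.disjoint) _ h2 (Q.mul_mem_left _ hb)
    rw [h1, sub_eq_zero] at h3
    exact h3.symm
  refine ⟨a, ha, hx a ha, fun h0 ↦ hP.ne_bot ((Submodule.eq_bot_iff P).2 fun x hxP ↦ ?_)⟩
  rw [← hx x hxP, h0, mul_zero]

theorem IsIdempotentElem.eq_zero_of_mem_jacobson {A : Type*} [Ring A] {a : A}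
    (ha : IsIdempotentElem a) (hJ : a ∈ Ring.jacobson A) : a = 0 := by
  obtain ⟨z, hz⟩ := Ring.mem_jacobson_iff_exists_mul_add_one.1 hJ (-1)
  have : (-1 * a + 1) * a = 0 := by rw [add_mul, mul_assoc, ha.eq]; simp
  rw [← one_mul a, ← hz, mul_assoc, this, mul_zero]

theorem theorem4p1 {F : Type*} [Field F] (p : ℕ) [Fact p.Prime] [CharP F p]
    {G : Type*} [Group G] [Finite G] (N : Subgroup G) [N.Normal] :
    (∀ e : MonoidAlgebra F G, IsBlockIdempotent e →
      ∀ P Q : Ideal (MonoidAlgebra F G),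
        IsPrincipalIndecomposable P → IsPrincipalIndecomposable Q →
        BelongsToBlock e P → BelongsToBlock e Q →
        ((P : Set (MonoidAlgebra F G)) ⊆ radicalRightAnnihilator F N ↔
          (Q : Set (MonoidAlgebra F G)) ⊆ radicalRightAnnihilator F N)) ∧
    (∀ (e : MonoidAlgebra F G) (he : IsBlockIdempotent e),
      ((blockIdeal e : Set (MonoidAlgebra F G)) ⊆ radicalRightAnnihilator F N ∨
        (blockIdeal e : Set (MonoidAlgebra F G)) ∩ radicalRightAnnihilator F N
          ⊆ blockRadical he.idem) ∧
      (blockIdeal e : Set (MonoidAlgebra F G)) ∩ radicalRightAnnihilator F N =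
        (fun a => a * e) '' (radicalRightAnnihilator F N : Set (MonoidAlgebra F G)) ∧
      blockRadical he.idem =
        ((blockIdeal e * Ring.jacobson (MonoidAlgebra F G) : Ideal (MonoidAlgebra F G)) :
          Set (MonoidAlgebra F G)) ∧
      blockRadical he.idem =
        (fun a => a * e) '' (Ring.jacobson (MonoidAlgebra F G) : Set (MonoidAlgebra F G))) := by
  constructor
  · intro e he
    -- The criterion `e ∈ I` depends only on the block. If it failed, a nonzero idempotent `ε = ε e`
    -- of `P ⊆ I` would lie in the radical.
    have key : ∀ P : Ideal (MonoidAlgebra F G), IsPrincipalIndecomposable P →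
        BelongsToBlock e P → ((P : Set (MonoidAlgebra F G)) ⊆ radicalRightAnnihilator F N ↔
          e ∈ radicalRightAnnihilator F N) := by
      intro P hP hPe
      constructor
      · intro hPI
        rcases he.mem_radicalRightAnnihilator_or N with h | h
        · exact h
        · obtain ⟨ε, hεP, hε, hne⟩ := hP.exists_idempotent
          refine absurd (hε.eq_zero_of_mem_jacobson ?_) hne
          have := h ε (hPI hεP)
          rwa [Semigroup.mem_center_iff.1 he.central, hPe ε hεP] at this
      · intro h x hx
        rw [← hPe x hx]
        exact mul_mem_radicalRightAnnihilator N h x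
    intro P Q hP hQ hPe hQe
    rw [key P hP hPe, key Q hQ hQe]
  · intro e he
    have hec := Semigroup.mem_center_iff.1 he.central
    have hrad := blockRadical_eq he.central he.idem
    have hB : ∀ x ∈ blockIdeal e, x * e = x := fun x ↦ mul_eq_self_of_mem_blockIdeal he.idem
    refine ⟨?_, ?_, hrad.trans ?_, hrad⟩
    · rcases he.mem_radicalRightAnnihilator_or N with h | h
      · left
        intro x hx
        rw [← hB x hx]
        exact mul_mem_radicalRightAnnihilator_left N x h
      · right
        rintro x ⟨hxB, hxI⟩
        rw [hrad]
        exact ⟨x, hB x hxB ▸ h x hxI, hB x hxB⟩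
    · ext x
      constructor
      · rintro ⟨hxB, hxI⟩
        exact ⟨x, hxI, hB x hxB⟩
      · rintro ⟨a, ha, rfl⟩
        exact ⟨Ideal.mem_span_singleton'.2 ⟨a, rfl⟩, mul_mem_radicalRightAnnihilator N ha e⟩
    · exact (coe_blockIdeal_mul he.central he.idem _).symm
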